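/- Consider a source $S$, a destination $D$ and a jammer $J$ with $N_J\ge 1$ antennas and a battery of infinite capacity, operating in blocks $n=0,1,2,\dots$ of length $T>0$. Let $\mathcal P_s>0$ be the source power, $\mathcal P_J\ge 0$ the target jamming power, $\eta>0$ the energy conversion efficiency, $m\in\mathbb R$ the path loss exponent, $d_{SJ},d_{SD},d_{JD}>0$ the distances, $\sigma_d^2>0$ the noise variance at $D$, and $R_t\ge R_s\ge 0$ the codeword rate and the secret rate. In block $n$ the fading coefficients are $\bm h_{SJ}(n)\in\mathbb C^{N_J}$, $h_{SD}(n)\in\mathbb C$, $\bm h_{JD}(n)\in\mathbb C^{N_J}$; all their entries, over all blocks, are independent circularly symmetric complex Gaussian random variables of zero mean and unit variance. The SINR at $D$ is $$\gamma_d(n)=\begin{cases}\dfrac{\mathcal P_s d_{SD}^{-m}|h_{SD}(n)|^2}{\sigma_d^2+\mathcal P_J d_{JD}^{-m}|h_{JD}(n)|^2}, & N_J=1,\\[2mm] \dfrac{\mathcal P_s|h_{SD}(n)|^2}{d_{SD}^m\sigma_d^2}, & N_J>1,\end{cases}$$ and block $n$ suffers a connection outage if $R_t>\log_2(1+\gamma_d(n))$.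 If at the beginning of block $n$ the battery energy $E_n$ is at least $\mathcal P_JT$ and there is no connection outage, the block is an information transmission (IT) block and $E_{n+1}=E_n-\mathcal P_JT$; otherwise it is a power transfer (PT) block and $E_{n+1}=E_n+\eta\,\mathcal P_s d_{SJ}^{-m}\|\bm h_{SJ}(n)\|^2T$. The initial energy $E_0\ge0$ is independent of the fading coefficients (for instance $E_0=0$). Then the mean energy harvested in a PT block, $\rho_J:=\mathbb E[\eta\,\mathcal P_s d_{SJ}^{-m}\|\bm h_{SJ}(n)\|^2T]$, is $\rho_J=\eta N_J\mathcal P_sT/d_{SJ}^m$; with $\rho_d=\mathcal P_s/(d_{SD}^m\sigma_d^2)$ and $\varphi=\frac{\mathcal P_J}{\mathcal P_s}\frac{d_{SD}^m}{d_{JD}^m}$, the connection outage probability $p_{co}:=\mathbb P\{R_t>\log_2(1+\gamma_d(n))\}$ is $$p_{co}=\begin{cases}1-\dfrac{e^{-(2^{R_t}-1)/\rho_d}}{1+\varphi(2^{R_t}-1)}, & N_J=1,\\[2mm] 1-e^{-(2^{R_t}-1)/\rho_d}, & N_J>1;\end{cases}$$ and the long-run information transmission probability is $$p_{tx}=\frac{1}{1+\max\left\{\frac{\mathcal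 P_JT}{\rho_J},\frac{p_{co}}{1-p_{co}}\right\}}$$ in each of the following senses: almost surely, the fraction of IT blocks among the first $n$ blocks tends to $p_{tx}$ as $n\to\infty$; the probability that a block is an IT block, averaged over the first $n$ blocks, tends to $p_{tx}$; and if all the $E_n$ have the law of $E_0$ (stationarity), then every block is an IT block with probability $p_{tx}$. Consequently, almost surely, the average over the first $n$ blocks of the delivered confidential rate ($R_s$ in an IT block, $0$ in a PT block) tends to the throughput $\pi=p_{tx}R_s$. -/

import Mathlib

namespace PoweredJammer

open MeasureTheory ProbabilityTheory

/-- The circularly symmetric complex Gaussian law with zero mean and unit variance: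
the real and imaginary parts are independent real Gaussians of mean `0` and variance `1/2`. -/
noncomputable def stdComplexGaussian : Measure ℂ :=
  ((gaussianReal 0 (1 / 2)).prod (gaussianReal 0 (1 / 2))).map
    (fun z : ℝ × ℝ => (⟨z.1, z.2⟩ : ℂ))

/-- The design and physical parameters. -/
structure Params where
  /-- number of antennas of the jammer -/
  NJ : ℕ
  /-- transmit power of the source -/
  Ps : ℝ
  /-- target jamming power -/
  PJ : ℝ
  /-- duration of a block -/
  T : ℝ
  /-- RF-DC energy conversion efficiency -/
  η : ℝ
  /-- path loss exponent -/
  m : ℝ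
  /-- distance source-jammer -/
  dSJ : ℝ
  /-- distance source-destination -/
  dSD : ℝ
  /-- distance jammer-destination -/
  dJD : ℝ
  /-- standard deviation of the noise at the destination -/
  σd : ℝ
  /-- rate of codeword transmission -/
  Rt : ℝ
  /-- rate of secret information -/
  Rs : ℝ
  NJ_pos : 0 < NJ
  Ps_pos : 0 < Ps
  PJ_nonneg : 0 ≤ PJ
  T_pos : 0 < T
  η_pos : 0 < η
  dSJ_pos : 0 < dSJ
  dSD_pos : 0 < dSD
  dJD_pos : 0 < dJD
  σd_pos : 0 < σd
  Rs_nonneg : 0 ≤ Rs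
  Rs_le_Rt : Rs ≤ Rt

/-- The scalar fading coefficients of one block: the link source-destination, and, for each of
the `N` antennas of the jammer, the links source-jammer and jammer-destination. -/
inductive Link (N : ℕ) : Type
  | SD : Link N
  | SJ : Fin N → Link N
  | JD : Fin N → Link N

variable {Ω : Type*}

/-- The fading coefficients `h n l` (block `n`, link `l`) are independent over all links and all
blocks, each standard complex Gaussian; the initial energy `E₀` of the battery is nonnegative and
independent of all the fading coefficients (for instance `E₀ = 0`). -/
structure IsFadingModel [MeasurableSpace Ω] (P : Params) (μ : Measure Ω)
    (h : ℕ → Link P.NJ → Ω → ℂ) (E₀ : Ω → ℝ) : Prop where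
  measurable_h : ∀ n l, Measurable (h n l)
  law_h : ∀ n l, μ.map (h n l) = stdComplexGaussian
  indep_h : iIndepFun (fun i : ℕ × Link P.NJ => h i.1 i.2) μ
  measurable_init : Measurable E₀
  init_nonneg : ∀ ω, 0 ≤ E₀ ω
  indep_init : IndepFun E₀ (fun ω => fun i : ℕ × Link P.NJ => h i.1 i.2 ω) μ

namespace Params

variable (P : Params) (h : ℕ → Link P.NJ → Ω → ℂ) (E₀ : Ω → ℝ)

/-- Energy harvested by the jammer in block `n` if that block is used for power transfer. -/
noncomputable def harvest (n : ℕ) (ω : Ω) : ℝ :=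
  P.η * (∑ k : Fin P.NJ,
    ‖((1 / √(P.dSJ ^ P.m) * √P.Ps : ℝ) : ℂ) * h n (Link.SJ k) ω‖ ^ 2) * P.T

/-- SINR at the destination in block `n`. A single-antenna jammer interferes with the destination;
a multi-antenna jammer transmits in the null space of the jammer-destination channel. -/
noncomputable def sinr (n : ℕ) (ω : Ω) : ℝ :=
  if P.NJ = 1 then
    (P.Ps / P.dSD ^ P.m * ‖h n Link.SD ω‖ ^ 2) /
      (P.σd ^ 2 + P.PJ / P.dJD ^ P.m * ‖h n (Link.JD ⟨0, P.NJ_pos⟩) ω‖ ^ 2)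
  else
    P.Ps * ‖h n Link.SD ω‖ ^ 2 / (P.dSD ^ P.m * P.σd ^ 2)

/-- Capacity of the link source-destination in block `n`. -/
noncomputable def capacity (n : ℕ) (ω : Ω) : ℝ :=
  Real.logb 2 (1 + P.sinr h n ω)

/-- Connection outage event in block `n`. -/
def outage (n : ℕ) : Set Ω := {ω | P.Rt > P.capacity h n ω}

open Classical in
/-- Energy in the battery of the jammer at the beginning of block `n`. If it is at least `PJ * T`
and there is no connection outage, then the block is used for information transmission
and `PJ * T` is spent on jamming; otherwise the block is used for power transfer. -/
noncomputable def battery : ℕ → Ω → ℝ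
  | 0, ω => E₀ ω
  | n + 1, ω =>
    if P.PJ * P.T ≤ battery n ω ∧ ω ∉ P.outage h n then battery n ω - P.PJ * P.T
    else battery n ω + P.harvest h n ω

/-- The event that block `n` is used for information transmission. -/
def itBlock (n : ℕ) : Set Ω :=
  {ω | P.PJ * P.T ≤ P.battery h E₀ n ω ∧ ω ∉ P.outage h n}

open Classical in
/-- Number of information transmission blocks among the first `n` blocks. -/
noncomputable def numIT (n : ℕ) (ω : Ω) : ℕ :=
  ((Finset.range n).filter (fun i => ω ∈ P.itBlock h E₀ i)).card

/-- Confidential rate delivered to the destination in block `n`: `Rs` in an information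
transmission block, `0` in a power transfer block. -/
noncomputable def deliveredRate (n : ℕ) : Ω → ℝ :=
  (P.itBlock h E₀ n).indicator (fun _ => P.Rs)

/-- Closed form of the mean energy harvested in a power transfer block. -/
noncomputable def ρJ : ℝ := P.η * P.NJ * P.Ps * P.T / P.dSJ ^ P.m

/-- SNR at the destination without jamming. -/
noncomputable def ρd : ℝ := P.Ps / (P.dSD ^ P.m * P.σd ^ 2)

noncomputable def φ : ℝ := P.PJ / P.Ps * (P.dSD ^ P.m / P.dJD ^ P.m)

/-- Closed form of the connection outage probability. -/
noncomputable def pco : ℝ :=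
  if P.NJ = 1 then
    1 - Real.exp (-((2 ^ P.Rt - 1) / P.ρd)) / (1 + P.φ * (2 ^ P.Rt - 1))
  else
    1 - Real.exp (-((2 ^ P.Rt - 1) / P.ρd))

/-- Closed form of the information transmission probability. -/
noncomputable def ptx : ℝ :=
  1 / (1 + max (P.PJ * P.T / P.ρJ) (P.pco / (1 - P.pco)))

end Params

end PoweredJammer

/-! The frequency of IT blocks is found from two conservation laws along almost every path; no
invariant law of the battery is constructed. Put `c = PJ * T`, `ρ = ρJ`, `q = 1 - pco`, and let `A
n` count the IT blocks among the first `n`. Up to errors `o(n)`, energy balance gives `E n = ρ * (n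
- A n) - c * A n`, and the outage statistics give `A n = q * B n`, where `B n` counts the blocks
that start with enough energy. Since `E n ≥ 0` and `B n ≤ n`, the limiting frequency is at most `min
q (ρ / (ρ + c))`, which is `ptx` (`Params.ptx_eq_min`).

For the lower bound, cut the path at the last block before `n` whose battery is below `c`. Up to
that block almost all the harvested energy has been spent, so the frequency there is about `ρ / (ρ +
c)`. After it only outages prevent transmission, so the frequency is about `q`. Both are at least
the minimum. This deterministic argument is `tendsto_avg_of_storage`.

The `o(n)` errors are averages of bounded predictable weights times centered noise, and
`ae_tendsto_avg_predictable_mul` removes them by martingale convergence and Kronecker's lemma. The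
delicate point is what counts as the past. The decision of block `n` depends on an outage in the
same block, but not on its source-jammer links, hence the two filtrations built on `beforeBlock` and
`beforeHarvest`.

The closed forms rest on `‖z‖ ^ 2` being exponential of rate 1 under `stdComplexGaussian`. The
averaged and the stationary statements follow from the almost sure one by dominated convergence. -/

namespace PoweredJammer

open MeasureTheory ProbabilityTheory Filter Topology

/-! ### Averages of real sequences -/

/-- A sequence is sublinear iff it is dominated, for each slope `ε > 0`, by an affine function of
slope `ε`. -/
theorem tendsto_div_nat_zero_iff (u : ℕ → ℝ) :
    Tendsto (fun n : ℕ => u n / n) atTop (𝓝 0) ↔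
      ∀ ε > 0, ∃ K, ∀ n : ℕ, |u n| ≤ ε * n + K := by
  constructor
  · intro hu ε hε
    obtain ⟨N, hN⟩ := (Metric.tendsto_atTop.1 hu) ε hε
    refine ⟨∑ i ∈ Finset.range (N + 1), |u i|, fun n => ?_⟩
    have hsum : 0 ≤ ∑ i ∈ Finset.range (N + 1), |u i| :=
      Finset.sum_nonneg fun i _ => abs_nonneg _
    rcases le_or_gt n N with hn | hn
    · have h1 := Finset.single_le_sum (f := fun i => |u i|) (fun i _ => abs_nonneg (u i))
        (Finset.mem_range.2 (Nat.lt_succ_of_le hn))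
      have h2 : 0 ≤ ε * n := by positivity
      linarith
    · have h1 := hN n hn.le
      have hpos : (0 : ℝ) < n := by exact_mod_cast (Nat.zero_le N).trans_lt hn
      rw [Real.dist_eq, sub_zero, abs_div, abs_of_pos hpos, div_lt_iff₀ hpos] at h1
      linarith
  · intro hu
    rw [Metric.tendsto_atTop]
    intro ε hε
    obtain ⟨K, hK⟩ := hu (ε / 2) (by positivity)
    obtain ⟨N, hN⟩ := exists_nat_gt (2 * K / ε)
    refine ⟨N + 1, fun n hn => ?_⟩
    have hNn : (N : ℝ) + 1 ≤ n := by exact_mod_cast hn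
    have hpos : (0 : ℝ) < n := by exact_mod_cast (Nat.succ_pos N).trans_le hn
    rw [Real.dist_eq, sub_zero, abs_div, abs_of_pos hpos, div_lt_iff₀ hpos]
    rw [div_lt_iff₀ hε] at hN
    have := hK n
    nlinarith

/-- Kronecker's lemma for the weights `i + 1`. -/
theorem tendsto_avg_zero_of_tendsto_sum_div {d : ℕ → ℝ} {l : ℝ}
    (hd : Tendsto (fun n => ∑ i ∈ Finset.range n, d i / ((i : ℝ) + 1)) atTop (𝓝 l)) :
    Tendsto (fun n : ℕ => (∑ i ∈ Finset.range n, d i) / n) atTop (𝓝 0) := by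
  set M : ℕ → ℝ := fun n => ∑ i ∈ Finset.range n, d i / ((i : ℝ) + 1) with hM
  -- Summation by parts. After division by `n`, the right side is `M n` minus its Cesàro mean, and
  -- both tend to `l`.
  have key : ∀ n : ℕ, ∑ i ∈ Finset.range n, d i = n * M n - ∑ i ∈ Finset.range n, M i := by
    intro n
    induction n with
    | zero => simp
    | succ n ih =>
      have hs : M (n + 1) = M n + d n / ((n : ℝ) + 1) := Finset.sum_range_succ _ _
      rw [Finset.sum_range_succ, ih, Finset.sum_range_succ, hs]
      have : (n : ℝ) + 1 ≠ 0 := by positivity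
      push_cast
      field_simp
      ring
  have h1 : Tendsto (fun n : ℕ => M n - (n : ℝ)⁻¹ * ∑ i ∈ Finset.range n, M i) atTop (𝓝 0) := by
    simpa using hd.sub hd.cesaro
  refine h1.congr' ?_
  filter_upwards [eventually_gt_atTop 0] with n hn
  have : (n : ℝ) ≠ 0 := by exact_mod_cast hn.ne'
  rw [key]
  field_simp

/-- A storage process: `E` is the stored amount, `x i = 1` if step `i` consumes `c`, which happens
if `c ≤ E i` and `y i = 1`, and otherwise step `i` supplies `X i`. If the supplied amounts are `ρ`
and the values `y i` are `q` on the average, then the frequency of the consuming steps is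
`min q (ρ / (ρ + c))`. -/
theorem tendsto_avg_of_storage {E x y X b : ℕ → ℝ} {c ρ q : ℝ} (hc : 0 ≤ c) (hρ : 0 < ρ)
    (hq0 : 0 ≤ q) (hE : ∀ n, 0 ≤ E n)
    (hstep : ∀ n, E (n + 1) = E n + (1 - x n) * X n - c * x n)
    (hx : ∀ n, x n = b n * y n) (hb1 : ∀ n, c ≤ E n → b n = 1) (hb0 : ∀ n, E n < c → b n = 0)
    (hX : Tendsto (fun n : ℕ => (∑ i ∈ Finset.range n, (1 - x i) * (X i - ρ)) / n) atTop (𝓝 0))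
    (hy : Tendsto (fun n : ℕ => (∑ i ∈ Finset.range n, b i * (y i - q)) / n) atTop (𝓝 0)) :
    Tendsto (fun n : ℕ => (∑ i ∈ Finset.range n, x i) / n) atTop (𝓝 (min q (ρ / (ρ + c)))) := by
  set r := ρ / (ρ + c) with hr
  have hρc : 0 < ρ + c := by linarith
  have hrρ : (ρ + c) * r = ρ := by rw [hr]; field_simp
  set p := min q r with hp
  have hpq : p ≤ q := min_le_left _ _
  have hpr : p ≤ r := min_le_right _ _
  have hp0 : 0 ≤ p := le_min hq0 (by positivity)
  set A : ℕ → ℝ := fun n => ∑ i ∈ Finset.range n, x i with hA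
  set B : ℕ → ℝ := fun n => ∑ i ∈ Finset.range n, b i with hB
  set S : ℕ → ℝ := fun n => ∑ i ∈ Finset.range n, (1 - x i) * (X i - ρ) with hS
  set N : ℕ → ℝ := fun n => ∑ i ∈ Finset.range n, b i * (y i - q) with hN
  -- Energy balance: the steps `hstep` telescope, with the supply `X i` replaced by its mean `ρ` at
  -- the cost of the error `S n`.
  have hbal : ∀ n : ℕ, (ρ + c) * A n = E 0 + S n + ρ * n - E n := by
    intro n
    induction n with
    | zero => simp [hA, hS]
    | succ n ih =>
      have h1 : A (n + 1) = A n + x n := Finset.sum_range_succ _ _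
      have h2 : S (n + 1) = S n + (1 - x n) * (X n - ρ) := Finset.sum_range_succ _ _
      rw [h1, h2, hstep]
      push_cast
      linear_combination ih
  have hAB : ∀ n : ℕ, A n = N n + q * B n := by
    intro n
    simp only [hA, hN, hB, Finset.mul_sum, ← Finset.sum_add_distrib]
    exact Finset.sum_congr rfl fun i _ => by rw [hx]; ring
  have hBle : ∀ n : ℕ, B n ≤ n := by
    intro n
    have : B n ≤ ∑ i ∈ Finset.range n, (1 : ℝ) := Finset.sum_le_sum fun i _ => by
      rcases le_or_gt c (E i) with h | h
      · rw [hb1 i h]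
      · rw [hb0 i h]; exact zero_le_one
    simpa using this
  -- `L` is the last time before `n` with stored amount below `c`, or `0` if there is none. Every
  -- later step has `b = 1`; the `- 1` allows for step `L` itself, where `b` may vanish.
  have hlast : ∀ n : ℕ, ∃ L ≤ n, (L = 0 ∨ E L < c) ∧ B L + ((n : ℝ) - L) - 1 ≤ B n := by
    intro n
    induction n with
    | zero => exact ⟨0, le_rfl, Or.inl rfl, by simp⟩
    | succ n ih =>
      have h1 : B (n + 1) = B n + b n := Finset.sum_range_succ _ _
      rcases le_or_gt c (E n) with h | h
      · obtain ⟨L, hL, hL', hLB⟩ := ih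
        refine ⟨L, hL.trans n.le_succ, hL', ?_⟩
        rw [h1, hb1 n h]
        push_cast
        linarith
      · refine ⟨n, n.le_succ, Or.inr h, ?_⟩
        rw [h1, hb0 n h]
        push_cast
        linarith
  have hmain : Tendsto (fun n : ℕ => (A n - p * n) / n) atTop (𝓝 0) := by
    rw [tendsto_div_nat_zero_iff]
    intro ε hε
    -- The lower bound meets the error `N` twice, at `n` and at `L`, and `S` once with factor `1 /
    -- (ρ + c)`. With slopes `ε / D` the total slope is `ε`. The affine bounds hold at every index,
    -- so they apply at `L`, which need not tend to infinity.
    set D := 2 + 1 / (ρ + c) with hD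
    have hi : 0 < 1 / (ρ + c) := by positivity
    have hDpos : 0 < D := by positivity
    obtain ⟨K₁, hK₁⟩ := (tendsto_div_nat_zero_iff _).1 hX (ε / D) (by positivity)
    obtain ⟨K₂, hK₂⟩ := (tendsto_div_nat_zero_iff _).1 hy (ε / D) (by positivity)
    set δ := ε / D with hδ
    have hδpos : 0 < δ := by positivity
    have hδD : δ * D = ε := by rw [hδ]; field_simp
    set K := max K₁ K₂ with hK
    have hS' : ∀ n : ℕ, |S n| ≤ δ * n + K := fun n => (hK₁ n).trans (by gcongr; exact le_max_left _ _)
    have hN' : ∀ n : ℕ, |N n| ≤ δ * n + K :=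
      fun n => (hK₂ n).trans (by gcongr; exact le_max_right _ _)
    have hK0 : 0 ≤ K := by simpa using (abs_nonneg _).trans (hS' 0)
    have hE0 := hE 0
    refine ⟨K * D + (E 0 + c) * (1 / (ρ + c)) + q, fun n => ?_⟩
    have hn0 : (0 : ℝ) ≤ n := n.cast_nonneg
    have hA_eq : ∀ k : ℕ, A k = r * k + (E 0 + S k - E k) * (1 / (ρ + c)) := by
      intro k
      have := hbal k
      rw [hr]
      field_simp
      linarith
    have hpos : 0 ≤ (E 0 + c) * (1 / (ρ + c)) := by positivity
    have hEi : 0 ≤ E 0 * (1 / (ρ + c)) := by positivity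
    have hci : 0 ≤ c * (1 / (ρ + c)) := by positivity
    have hδn : 0 ≤ δ * n := by positivity
    have hexp : ε * n + (K * D + (E 0 + c) * (1 / (ρ + c)) + q) =
        2 * (δ * n + K) + (δ * n + K) * (1 / (ρ + c)) + E 0 * (1 / (ρ + c)) + c * (1 / (ρ + c))
          + q := by
      rw [← hδD, hD]; ring
    have hKi : 0 ≤ (δ * n + K) * (1 / (ρ + c)) := by positivity
    rw [hexp, abs_le]
    constructor
    · obtain ⟨L, hLn, hL, hLB⟩ := hlast n
      have hLn' : (L : ℝ) ≤ n := by exact_mod_cast hLn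
      have hmono : δ * L + K ≤ δ * n + K := by gcongr
      have hNn := (abs_le.1 (hN' n)).1
      have hNL := (abs_le.1 (hN' L)).2
      have hSL := (abs_le.1 (hS' L)).1
      have h1 : A n - A L = N n - N L + q * (B n - B L) := by rw [hAB, hAB]; ring
      have h2 : q * ((n : ℝ) - L - 1) ≤ q * (B n - B L) :=
        mul_le_mul_of_nonneg_left (by linarith) hq0
      have h3 : r * L - (δ * n + K + c) * (1 / (ρ + c)) ≤ A L := by
        rcases hL with rfl | hL
        · have : 0 ≤ (δ * n + K + c) * (1 / (ρ + c)) := by positivity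
          simpa [hA] using this
        · rw [hA_eq L, sub_eq_add_neg, ← neg_mul]
          gcongr
          linarith
      have h4 : p * L ≤ r * L := mul_le_mul_of_nonneg_right hpr L.cast_nonneg
      have h5 : p * ((n : ℝ) - L) ≤ q * ((n : ℝ) - L) :=
        mul_le_mul_of_nonneg_right hpq (by linarith)
      have h6 : (δ * n + K + c) * (1 / (ρ + c)) =
        (δ * n + K) * (1 / (ρ + c)) + c * (1 / (ρ + c)) := by ring
      linarith
    · have hNn := (abs_le.1 (hN' n)).2
      have hSn := (abs_le.1 (hS' n)).2
      rcases min_choice q r with h | h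
      · have h1 : q * B n ≤ q * n := mul_le_mul_of_nonneg_left (hBle n) hq0
        rw [hp, h, hAB]
        linarith
      · have h1 : (E 0 + S n - E n) * (1 / (ρ + c)) ≤ (E 0 + (δ * n + K)) * (1 / (ρ + c)) := by
          gcongr
          have := hE n
          linarith
        rw [hp, h, hA_eq n]
        linarith
  have : Tendsto (fun n : ℕ => (A n - p * n) / n + p) atTop (𝓝 p) := by
    simpa using hmain.add_const p
  refine this.congr' ?_
  filter_upwards [eventually_gt_atTop 0] with n hn
  have : (n : ℝ) ≠ 0 := by exact_mod_cast hn.ne'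
  field_simp
  ring

/-! ### Independence and the strong law for predictable weights -/

/-- Adjoining a σ-algebra independent of a whole independent family keeps independence. -/
theorem iIndep_option {Ω ι : Type*} {mΩ : MeasurableSpace Ω} {μ : Measure Ω}
    {m₀ : MeasurableSpace Ω} {m : ι → MeasurableSpace Ω}
    (hm : iIndep m μ) (h₀ : Indep m₀ (⨆ i, m i) μ) :
    iIndep (fun o : Option ι => o.elim m₀ m) μ := by
  classical
  have := hm.isProbabilityMeasure
  rw [iIndep_iff]
  intro s f hf
  have hsome : ∀ i ∈ s.eraseNone, MeasurableSet[m i] (f (some i)) :=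
    fun i hi => hf (some i) (Finset.mem_eraseNone.1 hi)
  have h1 := hm.meas_biInter hsome
  by_cases hn : none ∈ s
  · have hs : s = Finset.insertNone s.eraseNone := by
      rw [Finset.insertNone_eraseNone, Finset.insert_eq_of_mem hn]
    have hI : (⋂ i ∈ s, f i) = f none ∩ ⋂ i ∈ s.eraseNone, f (some i) := by
      ext ω
      simp only [Set.mem_iInter, Set.mem_inter_iff, Finset.mem_eraseNone]
      exact ⟨fun h => ⟨h _ hn, fun i hi => h _ hi⟩, fun h o ho => by
        cases o with
        | none => exact h.1
        | some i => exact h.2 i ho⟩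
    have hmeas : MeasurableSet[⨆ i, m i] (⋂ i ∈ s.eraseNone, f (some i)) :=
      @Finset.measurableSet_biInter _ _ (⨆ i, m i) _ _
        fun i hi => (le_iSup m i) _ (hsome i hi)
    rw [hI, (Indep_iff _ _ _).1 h₀ _ _ (hf none hn) hmeas, h1]
    conv_rhs => rw [hs]
    rw [Finset.prod_insertNone]
  · have hs : s = s.eraseNone.map Function.Embedding.some := by
      rw [Finset.map_some_eraseNone, Finset.erase_eq_of_notMem hn]
    have hI : (⋂ i ∈ s, f i) = ⋂ i ∈ s.eraseNone, f (some i) := by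
      ext ω
      simp only [Set.mem_iInter, Finset.mem_eraseNone]
      exact ⟨fun h i hi => h _ hi, fun h o ho => by
        cases o with
        | none => exact absurd ho hn
        | some i => exact h i ho⟩
    rw [hI, h1]
    conv_rhs => rw [hs]
    rw [Finset.prod_map]
    rfl

/-- Strong law of large numbers for martingale differences `W i * Z i`, where the weight `W i` is
bounded and known before time `i`, and the centered noise `Z i` is independent of the past. -/
theorem ae_tendsto_avg_predictable_mul {Ω : Type*} {mΩ : MeasurableSpace Ω} {μ : Measure Ω}
    [IsProbabilityMeasure μ] (𝒢 : Filtration ℕ mΩ) {W Z : ℕ → Ω → ℝ} {C : ℝ}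
    (hW : ∀ n, Measurable[𝒢 n] (W n)) (hW1 : ∀ n ω, |W n ω| ≤ 1)
    (hZ : ∀ n, Measurable[𝒢 (n + 1)] (Z n)) (hZ2 : ∀ n, MemLp (Z n) 2 μ)
    (hZC : ∀ n, ∫ ω, Z n ω ^ 2 ∂μ ≤ C) (hZ0 : ∀ n, ∫ ω, Z n ω ∂μ = 0)
    (hind : ∀ n, Indep (𝒢 n) (MeasurableSpace.comap (Z n) inferInstance) μ) :
    ∀ᵐ ω ∂μ, Tendsto (fun n : ℕ => (∑ i ∈ Finset.range n, W i ω * Z i ω) / n)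
      atTop (𝓝 0) := by
  have hZm : ∀ n, Measurable (Z n) := fun n => (hZ n).mono (𝒢.le _) le_rfl
  have hWm : ∀ n, Measurable (W n) := fun n => (hW n).mono (𝒢.le _) le_rfl
  -- The noise is orthogonal to everything known before it. This one fact gives the martingale
  -- property (`V` an indicator times the weight) and removes the cross terms in the second moment.
  -- `V` need not be integrable.
  have horth : ∀ n (V : Ω → ℝ), Measurable[𝒢 n] V → ∫ ω, V ω * Z n ω ∂μ = 0 := by
    intro n V hV
    have hi : IndepFun V (Z n) μ := by
      rw [IndepFun_iff_Indep]
      exact indep_of_indep_of_le_left (hind n) hV.comap_le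
    have := hi.integral_mul_eq_mul_integral
      (hV.mono (𝒢.le _) le_rfl).aestronglyMeasurable (hZm n).aestronglyMeasurable
    simpa [hZ0] using this
  set M : ℕ → Ω → ℝ :=
    fun n ω => ∑ i ∈ Finset.range n, W i ω * Z i ω / ((i : ℝ) + 1) with hM
  have hMs : ∀ n ω, M (n + 1) ω = M n ω + W n ω * Z n ω / ((n : ℝ) + 1) :=
    fun n ω => Finset.sum_range_succ _ _
  have hD2 : ∀ n, MemLp (fun ω => W n ω * Z n ω / ((n : ℝ) + 1)) 2 μ := by
    intro n
    have h1 : MemLp (fun ω => W n ω * Z n ω) 2 μ := by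
      refine (hZ2 n).of_le ((hWm n).mul (hZm n)).aestronglyMeasurable (ae_of_all _ fun ω => ?_)
      rw [norm_mul]
      exact mul_le_of_le_one_left (norm_nonneg _) (hW1 n ω)
    simpa [div_eq_mul_inv] using h1.mul_const ((n : ℝ) + 1)⁻¹
  have hMad : ∀ n, Measurable[𝒢 n] (M n) := by
    intro n
    refine Finset.measurable_fun_sum _ fun i hi => ?_
    have hin : i + 1 ≤ n := Finset.mem_range.1 hi
    exact (((hW i).mono (𝒢.mono (i.le_succ.trans hin)) le_rfl).mul
      ((hZ i).mono (𝒢.mono hin) le_rfl)).div_const _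
  have hM2 : ∀ n, MemLp (M n) 2 μ := fun n => memLp_finsetSum _ fun i _ => hD2 i
  have hMint : ∀ n, Integrable (M n) μ := fun n => (hM2 n).integrable one_le_two
  have hDint : ∀ n, Integrable (fun ω => W n ω * Z n ω / ((n : ℝ) + 1)) μ :=
    fun n => (hD2 n).integrable one_le_two
  have hmart : Martingale M 𝒢 μ := by
    refine martingale_of_setIntegral_eq_succ (fun n => (hMad n).stronglyMeasurable) hMint ?_
    intro n s hs
    simp_rw [hMs]
    rw [integral_add (hMint n).integrableOn (hDint n).integrableOn, left_eq_add,
      ← integral_indicator (𝒢.le n _ hs)]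
    rw [← horth n (s.indicator fun ω => W n ω / ((n : ℝ) + 1))
      (((hW n).div_const _).indicator hs)]
    refine integral_congr_ae (ae_of_all _ fun ω => ?_)
    by_cases hω : ω ∈ s
    · simp [hω]; ring
    · simp [hω]
  -- Orthogonal increments make second moments add, and the weights `1 / (i + 1) ^ 2` are summable,
  -- so `M` is bounded in L².
  have hsq : ∀ n, ∫ ω, M n ω ^ 2 ∂μ ≤ ∑ i ∈ Finset.range n, C * (1 / ((i : ℝ) + 1) ^ 2) := by
    intro n
    induction n with
    | zero => simp [hM]
    | succ n ih =>
      rw [Finset.sum_range_succ]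
      have hn : (0 : ℝ) < (n : ℝ) + 1 := by positivity
      have hexp : ∀ ω, M (n + 1) ω ^ 2 = M n ω ^ 2
          + (2 * (M n ω * W n ω / ((n : ℝ) + 1)) * Z n ω
            + (W n ω * Z n ω / ((n : ℝ) + 1)) ^ 2) := by
        intro ω; rw [hMs]; ring
      have hcross : Integrable (fun ω => 2 * (M n ω * W n ω / ((n : ℝ) + 1)) * Z n ω) μ := by
        have := ((hM2 n).integrable_mul (hD2 n)).const_mul 2
        refine this.congr (ae_of_all _ fun ω => ?_)
        simp only [Pi.mul_apply]; ring
      have hDsq : Integrable (fun ω => (W n ω * Z n ω / ((n : ℝ) + 1)) ^ 2) μ :=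
        (hD2 n).integrable_sq
      have hrest : Integrable (fun ω => 2 * (M n ω * W n ω / ((n : ℝ) + 1)) * Z n ω
          + (W n ω * Z n ω / ((n : ℝ) + 1)) ^ 2) μ := hcross.add hDsq
      simp_rw [hexp]
      rw [integral_add (hM2 n).integrable_sq hrest, integral_add hcross hDsq,
        horth n (fun ω => 2 * (M n ω * W n ω / ((n : ℝ) + 1)))
          ((((hMad n).mul (hW n)).div_const _).const_mul 2), zero_add]
      refine add_le_add ih ?_
      calc ∫ ω, (W n ω * Z n ω / ((n : ℝ) + 1)) ^ 2 ∂μ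
          ≤ ∫ ω, Z n ω ^ 2 * (1 / ((n : ℝ) + 1) ^ 2) ∂μ := by
            refine integral_mono hDsq ((hZ2 n).integrable_sq.mul_const _) fun ω => ?_
            have h1 : W n ω ^ 2 ≤ 1 := by
              rw [sq_le_one_iff_abs_le_one]; exact hW1 n ω
            have : (W n ω * Z n ω / ((n : ℝ) + 1)) ^ 2
                = W n ω ^ 2 * (Z n ω ^ 2 * (1 / ((n : ℝ) + 1) ^ 2)) := by
              rw [div_pow, mul_pow]; ring
            simp only [this]
            exact mul_le_of_le_one_left (by positivity) h1
        _ = (∫ ω, Z n ω ^ 2 ∂μ) * (1 / ((n : ℝ) + 1) ^ 2) := integral_mul_const _ _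
        _ ≤ C * (1 / ((n : ℝ) + 1) ^ 2) := by gcongr; exact hZC n
  have hC : 0 ≤ C := (integral_nonneg fun ω => sq_nonneg _).trans (hZC 0)
  have hsummable : Summable fun i : ℕ => C * (1 / ((i : ℝ) + 1) ^ 2) := by
    refine Summable.mul_left _ ?_
    have := (summable_nat_add_iff 1).2 (Real.summable_one_div_nat_pow.2 one_lt_two)
    simpa using this
  -- The convergence theorem asks for an L¹ bound; `|x| ≤ 1 + x ^ 2` turns the L² bound into one,
  -- hence the summand `1`.
  set R := 1 + ∑' i : ℕ, C * (1 / ((i : ℝ) + 1) ^ 2) with hR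
  have hbdd : ∀ n, eLpNorm (M n) 1 μ ≤ (Real.toNNReal R : ENNReal) := by
    intro n
    rw [eLpNorm_one_eq_lintegral_enorm, ← ofReal_integral_norm_eq_lintegral_enorm (hMint n)]
    refine ENNReal.ofReal_le_ofReal ?_
    calc ∫ ω, ‖M n ω‖ ∂μ ≤ ∫ ω, (1 + M n ω ^ 2) ∂μ := by
          refine integral_mono (hMint n).norm ((integrable_const 1).add (hM2 n).integrable_sq)
            fun ω => ?_
          simp only [Real.norm_eq_abs]
          nlinarith [sq_nonneg (|M n ω| - 1), sq_abs (M n ω)]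
      _ = 1 + ∫ ω, M n ω ^ 2 ∂μ := by
          rw [integral_add (integrable_const 1) (hM2 n).integrable_sq]; simp
      _ ≤ R := by
          rw [hR]
          gcongr
          exact (hsq n).trans (hsummable.sum_le_tsum _ fun i _ => by positivity)
  filter_upwards [hmart.submartingale.exists_ae_tendsto_of_bdd hbdd] with ω ⟨l, hl⟩
  exact tendsto_avg_zero_of_tendsto_sum_div hl

end PoweredJammer

namespace PoweredJammer

open MeasureTheory ProbabilityTheory Filter Topology

/-! ### The standard complex Gaussian law -/

theorem measurable_complex_mk : Measurable (fun z : ℝ × ℝ => (⟨z.1, z.2⟩ : ℂ)) :=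
  Complex.measurableEquivRealProd.symm.measurable

instance : IsProbabilityMeasure stdComplexGaussian :=
  Measure.isProbabilityMeasure_map measurable_complex_mk.aemeasurable

/-- The integrand has the primitive `-exp (-(κ * r ^ 2)) / κ`. Taking `κ = 1`, `a = √t` gives the
tail of the squared modulus, and `κ = 1 + b`, `a = 0` its Laplace transform. -/
theorem lintegral_Ioi_two_mul_exp_neg_mul_sq {κ a : ℝ} (hκ : 0 < κ) (ha : 0 ≤ a) :
    ∫⁻ r in Set.Ioi a, ENNReal.ofReal (2 * r * Real.exp (-(κ * r ^ 2))) =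
      ENNReal.ofReal (Real.exp (-(κ * a ^ 2)) / κ) := by
  have hder : ∀ x ∈ Set.Ici a, HasDerivAt (fun r : ℝ => -Real.exp (-(κ * r ^ 2)) / κ)
      (2 * x * Real.exp (-(κ * x ^ 2))) x := by
    intro x _
    have h1 : HasDerivAt (fun r : ℝ => -(κ * r ^ 2)) (-(κ * (2 * x))) x := by
      simpa using ((hasDerivAt_pow 2 x).const_mul κ).fun_neg
    have h2 := h1.exp.fun_neg.div_const κ
    have h3 : -(Real.exp (-(κ * x ^ 2)) * -(κ * (2 * x))) / κ =
        2 * x * Real.exp (-(κ * x ^ 2)) := by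
      field_simp
    rwa [h3] at h2
  have hnonneg : ∀ x ∈ Set.Ioi a, 0 ≤ 2 * x * Real.exp (-(κ * x ^ 2)) := fun x hx => by
    have : 0 ≤ x := ha.trans (le_of_lt hx)
    positivity
  have hlim : Tendsto (fun r : ℝ => -Real.exp (-(κ * r ^ 2)) / κ) atTop (𝓝 0) := by
    have h1 : Tendsto (fun r : ℝ => κ * r ^ 2) atTop atTop :=
      (tendsto_pow_atTop two_ne_zero).const_mul_atTop hκ
    have h2 := (Real.tendsto_exp_neg_atTop_nhds_zero.comp h1).neg.div_const κ
    simpa [Function.comp_def] using h2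
  have hint := integrableOn_Ioi_deriv_of_nonneg' hder hnonneg hlim
  rw [← ofReal_integral_eq_lintegral_ofReal hint
    ((ae_restrict_iff' measurableSet_Ioi).2 (ae_of_all _ hnonneg)),
    integral_Ioi_of_hasDerivAt_of_nonneg' hder hnonneg hlim]
  congr 1
  ring

/-- The squared modulus of a standard complex Gaussian, in polar coordinates. -/
theorem lintegral_norm_sq_stdComplexGaussian {g : ℝ → ENNReal} (hg : Measurable g) :
    ∫⁻ z, g (‖z‖ ^ 2) ∂stdComplexGaussian =
      ∫⁻ r in Set.Ioi (0 : ℝ), ENNReal.ofReal (2 * r * Real.exp (-r ^ 2)) * g (r ^ 2) := by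
  have hv : (1 / 2 : NNReal) ≠ 0 := by norm_num
  -- Variance `1 / 2` makes the joint density radial with constant `1 / π`; the angular integral `2
  -- * π` then leaves the factor `2`.
  have hpdf : ∀ x y : ℝ, gaussianPDF 0 (1 / 2) x * gaussianPDF 0 (1 / 2) y =
      ENNReal.ofReal (Real.pi⁻¹ * Real.exp (-(x ^ 2 + y ^ 2))) := by
    intro x y
    rw [gaussianPDF, gaussianPDF, ← ENNReal.ofReal_mul (gaussianPDFReal_nonneg _ _ _)]
    congr 1
    simp only [gaussianPDFReal]
    have h1 : (2 * Real.pi * ((1 / 2 : NNReal) : ℝ)) = Real.pi := by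
      push_cast; ring
    have h2 : (2 * ((1 / 2 : NNReal) : ℝ)) = 1 := by push_cast; ring
    rw [h1, h2]
    have h3 : (√Real.pi)⁻¹ * (√Real.pi)⁻¹ = Real.pi⁻¹ := by
      rw [← mul_inv, Real.mul_self_sqrt Real.pi_pos.le]
    have h4 : Real.exp (-(x ^ 2 + y ^ 2)) =
        Real.exp (-(x - 0) ^ 2 / 1) * Real.exp (-(y - 0) ^ 2 / 1) := by
      rw [← Real.exp_add]; congr 1; ring
    rw [h4, ← h3]
    ring
  have hgm : Measurable fun z : ℂ => g (‖z‖ ^ 2) := hg.comp (by fun_prop)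
  rw [stdComplexGaussian, lintegral_map hgm measurable_complex_mk,
    gaussianReal_of_var_ne_zero _ hv,
    prod_withDensity (measurable_gaussianPDF _ _) (measurable_gaussianPDF _ _)]
  erw [lintegral_withDensity_eq_lintegral_mul _ (by fun_prop) (hgm.comp measurable_complex_mk)]
  simp only [Function.comp_def]
  simp only [Pi.mul_apply, hpdf]
  have hnorm : ∀ z : ℝ × ℝ, ‖(⟨z.1, z.2⟩ : ℂ)‖ ^ 2 = z.1 ^ 2 + z.2 ^ 2 := by
    intro z
    rw [Complex.sq_norm, Complex.normSq_mk]
    ring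
  simp only [hnorm]
  rw [← Measure.volume_eq_prod, ← lintegral_comp_polarCoord_symm]
  have hpol : ∀ p : ℝ × ℝ, (polarCoord.symm p).1 ^ 2 + (polarCoord.symm p).2 ^ 2 = p.1 ^ 2 := by
    intro p
    simp only [polarCoord_symm_apply]
    linear_combination p.1 ^ 2 * Real.sin_sq_add_cos_sq p.2
  simp only [hpol]
  have hms : Measurable fun r : ℝ => ENNReal.ofReal r •
      (ENNReal.ofReal (Real.pi⁻¹ * Real.exp (-r ^ 2)) * g (r ^ 2)) := by
    have : Measurable fun r : ℝ => g (r ^ 2) := hg.comp (by fun_prop)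
    fun_prop
  rw [polarCoord_target, Measure.volume_eq_prod, ← Measure.prod_restrict,
    lintegral_prod (fun p : ℝ × ℝ => ENNReal.ofReal p.1 •
      (ENNReal.ofReal (Real.pi⁻¹ * Real.exp (-p.1 ^ 2)) * g (p.1 ^ 2)))
      (hms.comp measurable_fst).aemeasurable]
  refine setLIntegral_congr_fun measurableSet_Ioi fun r hr => ?_
  have hr' : (0 : ℝ) < r := hr
  simp only [lintegral_const, Measure.restrict_apply_univ, Real.volume_Ioo, smul_eq_mul]
  have hconst : ENNReal.ofReal r * ENNReal.ofReal (Real.pi⁻¹ * Real.exp (-r ^ 2)) *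
      ENNReal.ofReal (Real.pi - -Real.pi) = ENNReal.ofReal (2 * r * Real.exp (-r ^ 2)) := by
    rw [← ENNReal.ofReal_mul hr'.le, ← ENNReal.ofReal_mul (by positivity)]
    congr 1
    field_simp
    ring
  rw [← hconst]
  ring

theorem stdComplexGaussian_le_norm_sq {t : ℝ} (ht : 0 ≤ t) :
    stdComplexGaussian {z | t ≤ ‖z‖ ^ 2} = ENNReal.ofReal (Real.exp (-t)) := by
  have hm : MeasurableSet {z : ℂ | t ≤ ‖z‖ ^ 2} :=
    measurableSet_le measurable_const (by fun_prop)
  have h1 := lintegral_norm_sq_stdComplexGaussian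
    (g := (Set.Ici t).indicator 1) (measurable_one.indicator measurableSet_Ici)
  have h2 : ∀ z : ℂ, (Set.Ici t).indicator (1 : ℝ → ENNReal) (‖z‖ ^ 2) =
      {z : ℂ | t ≤ ‖z‖ ^ 2}.indicator 1 z := fun z => by
    simp [Set.indicator_apply]
  simp only [h2] at h1
  rw [lintegral_indicator_one hm] at h1
  have hsub : Set.Ici (√t) =ᵐ[volume] Set.Ioi (√t) := Ioi_ae_eq_Ici.symm
  have h3 := lintegral_Ioi_two_mul_exp_neg_mul_sq one_pos (Real.sqrt_nonneg t)
  simp only [one_mul, Real.sq_sqrt ht, div_one] at h3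
  rw [h1, ← h3, ← setLIntegral_congr hsub, ← lintegral_indicator measurableSet_Ioi,
    ← lintegral_indicator measurableSet_Ici]
  refine lintegral_congr fun r => ?_
  rcases le_or_gt r 0 with hr | hr
  · rw [Set.indicator_of_notMem (by simpa using hr)]
    by_cases h : r ∈ Set.Ici (√t)
    -- This can occur only for `t = 0`, and there the radial density `2 * r` vanishes.
    · have : r = 0 := le_antisymm hr ((Real.sqrt_nonneg t).trans h)
      simp [this, Set.indicator_apply]
    · rw [Set.indicator_of_notMem h]
  · have hiff : r ∈ Set.Ici (√t) ↔ r ^ 2 ∈ Set.Ici t := by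
      simp only [Set.mem_Ici]
      exact Real.sqrt_le_left hr.le
    rw [Set.indicator_of_mem (by simpa using hr)]
    by_cases h : r ∈ Set.Ici (√t)
    · rw [Set.indicator_of_mem h, Set.indicator_of_mem (hiff.1 h)]; simp
    · rw [Set.indicator_of_notMem h, Set.indicator_of_notMem (mt hiff.2 h)]; simp

/-- Laplace transform of the unit exponential law. It averages the success probability over the
interference of a single-antenna jammer. -/
theorem lintegral_exp_neg_mul_norm_sq_stdComplexGaussian {b : ℝ} (hb : 0 ≤ b) :
    ∫⁻ z, ENNReal.ofReal (Real.exp (-(b * ‖z‖ ^ 2))) ∂stdComplexGaussian =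
      ENNReal.ofReal (1 / (1 + b)) := by
  rw [lintegral_norm_sq_stdComplexGaussian (g := fun x => ENNReal.ofReal (Real.exp (-(b * x))))
    (by fun_prop)]
  have h := lintegral_Ioi_two_mul_exp_neg_mul_sq (κ := 1 + b) (by positivity) (le_refl (0 : ℝ))
  simp only [ne_eq, OfNat.ofNat_ne_zero, not_false_eq_true, zero_pow, mul_zero, neg_zero,
    Real.exp_zero] at h
  rw [← h]
  refine setLIntegral_congr_fun measurableSet_Ioi fun r hr => ?_
  have hr' : (0 : ℝ) < r := hr
  rw [← ENNReal.ofReal_mul (by positivity), mul_assoc, ← Real.exp_add]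
  congr 4
  ring

/-- Gaussian fourth moments are finite; this is what puts the harvested energy in L², as the strong
law requires. -/
theorem memLp_sq_gaussianReal (v : NNReal) : MemLp (fun x : ℝ => x ^ 2) 2 (gaussianReal 0 v) := by
  have h : MemLp (fun x : ℝ => x) 4 (gaussianReal 0 v) := memLp_id_gaussianReal 4
  have := h.norm_rpow_div 2
  have e : (4 : ENNReal) / 2 = 2 := by
    rw [show (4 : ENNReal) = 2 * 2 by norm_num]
    exact ENNReal.mul_div_cancel_right (by norm_num) (by norm_num)
  rw [e] at this
  simpa using this

theorem integral_sq_gaussianReal (v : NNReal) : ∫ x, x ^ 2 ∂gaussianReal 0 v = v := by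
  have h := variance_fun_id_gaussianReal (μ := 0) (v := v)
  rw [variance_eq_integral measurable_id'.aemeasurable] at h
  simpa [integral_id_gaussianReal] using h

theorem memLp_norm_sq_stdComplexGaussian :
    MemLp (fun z : ℂ => ‖z‖ ^ 2) 2 stdComplexGaussian := by
  rw [stdComplexGaussian, memLp_map_measure_iff (by fun_prop) measurable_complex_mk.aemeasurable]
  have h1 := (memLp_sq_gaussianReal (1 / 2)).comp_fst (gaussianReal 0 (1 / 2))
  have h2 := (memLp_sq_gaussianReal (1 / 2)).comp_snd (gaussianReal 0 (1 / 2))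
  refine (h1.add h2).ae_eq (ae_of_all _ fun z => ?_)
  simp only [Pi.add_apply, Function.comp_apply, Complex.sq_norm, Complex.normSq_mk]
  ring

theorem integral_norm_sq_stdComplexGaussian : ∫ z, ‖z‖ ^ 2 ∂stdComplexGaussian = 1 := by
  rw [stdComplexGaussian, integral_map measurable_complex_mk.aemeasurable (by fun_prop)]
  have hnorm : ∀ z : ℝ × ℝ, ‖(⟨z.1, z.2⟩ : ℂ)‖ ^ 2 = z.1 ^ 2 + z.2 ^ 2 := by
    intro z
    rw [Complex.sq_norm, Complex.normSq_mk]
    ring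
  simp only [hnorm]
  have hi := (memLp_sq_gaussianReal (1 / 2)).integrable one_le_two
  rw [integral_add (hi.comp_fst _) (hi.comp_snd _),
    integral_fun_fst (fun x : ℝ => x ^ 2), integral_fun_snd (fun x : ℝ => x ^ 2),
    integral_sq_gaussianReal]
  simp
  norm_num

end PoweredJammer

namespace PoweredJammer

open MeasureTheory ProbabilityTheory Filter Topology

namespace Params

variable {Ω : Type*} (P : Params) {h : ℕ → Link P.NJ → Ω → ℂ} {E₀ : Ω → ℝ}

/-! ### Closed forms -/

theorem ρJ_pos : 0 < P.ρJ := by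
  have := P.NJ_pos
  have := P.Ps_pos
  have := P.T_pos
  have := P.η_pos
  have := Real.rpow_pos_of_pos P.dSJ_pos P.m
  unfold ρJ
  positivity

theorem ρd_pos : 0 < P.ρd := by
  have := P.Ps_pos
  have := P.σd_pos
  have := Real.rpow_pos_of_pos P.dSD_pos P.m
  unfold ρd
  positivity

theorem φ_nonneg : 0 ≤ P.φ := by
  have := P.Ps_pos
  have := P.PJ_nonneg
  have := Real.rpow_pos_of_pos P.dSD_pos P.m
  have := Real.rpow_pos_of_pos P.dJD_pos P.m
  unfold φ
  positivity

theorem threshold_nonneg : 0 ≤ (2 : ℝ) ^ P.Rt - 1 :=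
  sub_nonneg.2 (Real.one_le_rpow one_le_two (P.Rs_nonneg.trans P.Rs_le_Rt))

theorem pco_lt_one : P.pco < 1 := by
  have h1 := P.threshold_nonneg
  have h2 := P.φ_nonneg
  unfold pco
  split_ifs
  · have : 0 < Real.exp (-((2 ^ P.Rt - 1) / P.ρd)) / (1 + P.φ * (2 ^ P.Rt - 1)) := by positivity
    linarith
  · have := Real.exp_pos (-((2 ^ P.Rt - 1) / P.ρd))
    linarith

/-- The map `t ↦ 1 / (1 + t)` is decreasing on `t ≥ 0`, so it turns the maximum of two ratios into
the minimum of two frequencies: the one allowed by outages and the one allowed by energy. -/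
theorem ptx_eq_min : P.ptx = min (1 - P.pco) (P.ρJ / (P.ρJ + P.PJ * P.T)) := by
  have hq : 0 < 1 - P.pco := sub_pos.2 P.pco_lt_one
  have hρ := P.ρJ_pos
  have hc : 0 ≤ P.PJ * P.T := mul_nonneg P.PJ_nonneg P.T_pos.le
  have e1 : 1 - P.pco = 1 / (1 + P.pco / (1 - P.pco)) := by field_simp; ring
  have e2 : P.ρJ / (P.ρJ + P.PJ * P.T) = 1 / (1 + P.PJ * P.T / P.ρJ) := by field_simp
  have p1 : 0 < 1 + P.pco / (1 - P.pco) := by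
    have : 1 + P.pco / (1 - P.pco) = 1 / (1 - P.pco) := by field_simp; ring
    rw [this]
    positivity
  have p2 : 0 < 1 + P.PJ * P.T / P.ρJ := by positivity
  unfold ptx
  rcases le_total (P.PJ * P.T / P.ρJ) (P.pco / (1 - P.pco)) with hle | hle
  · rw [max_eq_right hle, min_eq_left, ← e1]
    rw [e1, e2]
    exact one_div_le_one_div_of_le p2 (by linarith)
  · rw [max_eq_left hle, min_eq_right, ← e2]
    rw [e1, e2]
    exact one_div_le_one_div_of_le p1 (by linarith)

/-! ### Pathwise description -/

theorem harvest_eq (n : ℕ) (ω : Ω) : P.harvest h n ω =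
    ∑ k : Fin P.NJ, (P.η * P.Ps * P.T / P.dSJ ^ P.m) * ‖h n (Link.SJ k) ω‖ ^ 2 := by
  have hd := Real.rpow_pos_of_pos P.dSJ_pos P.m
  have hs : ∀ k : Fin P.NJ,
      ‖((1 / √(P.dSJ ^ P.m) * √P.Ps : ℝ) : ℂ) * h n (Link.SJ k) ω‖ ^ 2 =
        P.Ps / P.dSJ ^ P.m * ‖h n (Link.SJ k) ω‖ ^ 2 := by
    intro k
    rw [norm_mul, mul_pow, Complex.norm_real, Real.norm_eq_abs, sq_abs, mul_pow, div_pow,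
      Real.sq_sqrt hd.le, Real.sq_sqrt P.Ps_pos.le]
    ring
  simp only [harvest, hs]
  rw [← Finset.mul_sum, ← Finset.mul_sum]
  ring

theorem harvest_nonneg (n : ℕ) (ω : Ω) : 0 ≤ P.harvest h n ω := by
  have := P.η_pos
  have := P.T_pos
  unfold harvest
  positivity

theorem sinr_nonneg (n : ℕ) (ω : Ω) : 0 ≤ P.sinr h n ω := by
  have := P.Ps_pos
  have := P.PJ_nonneg
  have := Real.rpow_pos_of_pos P.dSD_pos P.m
  have := Real.rpow_pos_of_pos P.dJD_pos P.m
  unfold sinr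
  split_ifs <;> positivity

/-- Nonnegativity of the SINR keeps the argument of `Real.logb` positive, away from its default
values, so the logarithm can be inverted. -/
theorem notMem_outage_iff (n : ℕ) (ω : Ω) :
    ω ∉ P.outage h n ↔ (2 : ℝ) ^ P.Rt - 1 ≤ P.sinr h n ω := by
  have h0 := P.sinr_nonneg (h := h) n ω
  simp only [outage, capacity, Set.mem_ofPred_eq, gt_iff_lt, not_lt]
  rw [Real.le_logb_iff_rpow_le one_lt_two (by linarith), sub_le_iff_le_add']

/-- Clearing the denominator makes the condition affine in the jamming gain: for a fixed jammer
link, it is a tail event of the source-destination link. -/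
theorem notMem_outage_iff_of_NJ_eq_one (h1 : P.NJ = 1) (n : ℕ) (ω : Ω) :
    ω ∉ P.outage h n ↔
      (2 ^ P.Rt - 1) / P.ρd + P.φ * (2 ^ P.Rt - 1) * ‖h n (Link.JD ⟨0, P.NJ_pos⟩) ω‖ ^ 2 ≤
        ‖h n Link.SD ω‖ ^ 2 := by
  have hPs := P.Ps_pos
  have hPJ := P.PJ_nonneg
  have hσ := P.σd_pos
  have hSD := Real.rpow_pos_of_pos P.dSD_pos P.m
  have hJD := Real.rpow_pos_of_pos P.dJD_pos P.m
  rw [notMem_outage_iff, sinr, if_pos h1]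
  set g := ‖h n (Link.JD ⟨0, P.NJ_pos⟩) ω‖ ^ 2
  have hg : 0 ≤ g := by positivity
  have hden : 0 < P.σd ^ 2 + P.PJ / P.dJD ^ P.m * g := by positivity
  have hk : 0 < P.Ps / P.dSD ^ P.m := by positivity
  rw [le_div_iff₀ hden, ← div_le_iff₀' hk]
  have : (2 ^ P.Rt - 1) * (P.σd ^ 2 + P.PJ / P.dJD ^ P.m * g) / (P.Ps / P.dSD ^ P.m) =
      (2 ^ P.Rt - 1) / P.ρd + P.φ * (2 ^ P.Rt - 1) * g := by
    unfold ρd φ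
    field_simp
  rw [this]

theorem notMem_outage_iff_of_NJ_ne_one (h1 : P.NJ ≠ 1) (n : ℕ) (ω : Ω) :
    ω ∉ P.outage h n ↔ (2 ^ P.Rt - 1) / P.ρd ≤ ‖h n Link.SD ω‖ ^ 2 := by
  have hρ := P.ρd_pos
  rw [notMem_outage_iff, sinr, if_neg h1, div_le_iff₀ hρ, ρd]
  have : P.Ps * ‖h n Link.SD ω‖ ^ 2 / (P.dSD ^ P.m * P.σd ^ 2) =
      ‖h n Link.SD ω‖ ^ 2 * (P.Ps / (P.dSD ^ P.m * P.σd ^ 2)) := by ring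
  rw [this]

theorem battery_nonneg (h0 : ∀ ω, 0 ≤ E₀ ω) (n : ℕ) (ω : Ω) : 0 ≤ P.battery h E₀ n ω := by
  induction n with
  | zero => exact h0 ω
  | succ n ih =>
    rw [battery]
    split_ifs with hc
    · exact sub_nonneg.2 hc.1
    · exact add_nonneg ih (P.harvest_nonneg n ω)

theorem battery_succ (n : ℕ) (ω : Ω) : P.battery h E₀ (n + 1) ω =
    P.battery h E₀ n ω + (1 - (P.itBlock h E₀ n).indicator 1 ω) * P.harvest h n ω
      - P.PJ * P.T * (P.itBlock h E₀ n).indicator 1 ω := by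
  classical
  rw [battery]
  by_cases hc : P.PJ * P.T ≤ P.battery h E₀ n ω ∧ ω ∉ P.outage h n
  · rw [if_pos hc, Set.indicator_of_mem (show ω ∈ P.itBlock h E₀ n from hc)]
    simp
  · rw [if_neg hc, Set.indicator_of_notMem (show ω ∉ P.itBlock h E₀ n from hc)]
    simp

theorem numIT_eq_sum (n : ℕ) (ω : Ω) : (P.numIT h E₀ n ω : ℝ) =
    ∑ i ∈ Finset.range n, (P.itBlock h E₀ i).indicator 1 ω := by
  classical
  rw [numIT, Finset.card_filter]
  push_cast
  refine Finset.sum_congr rfl fun i _ => ?_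
  simp [Set.indicator_apply]

theorem itBlock_eq (n : ℕ) : P.itBlock h E₀ n =
    {ω | P.PJ * P.T ≤ P.battery h E₀ n ω} ∩ (P.outage h n)ᶜ := rfl

/-! ### Measurability -/

theorem measurable_indicator_one {mΩ : MeasurableSpace Ω} {s : Set Ω} (hs : MeasurableSet s) :
    Measurable (s.indicator (1 : Ω → ℝ)) :=
  measurable_one.indicator hs

theorem measurable_harvest {mΩ : MeasurableSpace Ω} {n : ℕ}
    (hSJ : ∀ k, Measurable (h n (Link.SJ k))) : Measurable (P.harvest h n) := by
  have : P.harvest h n = fun ω =>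
      ∑ k : Fin P.NJ, (P.η * P.Ps * P.T / P.dSJ ^ P.m) * ‖h n (Link.SJ k) ω‖ ^ 2 :=
    funext fun ω => P.harvest_eq n ω
  rw [this]
  fun_prop

theorem measurableSet_outage {mΩ : MeasurableSpace Ω} {n : ℕ} (hSD : Measurable (h n Link.SD))
    (hJD : ∀ k, Measurable (h n (Link.JD k))) : MeasurableSet (P.outage h n) := by
  have hs : Measurable (P.sinr h n) := by
    unfold sinr
    split_ifs
    · have := hJD ⟨0, P.NJ_pos⟩
      fun_prop
    · fun_prop
  have hc : Measurable (P.capacity h n) := by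
    unfold capacity Real.logb
    exact (Real.measurable_log.comp (hs.const_add 1)).div_const _
  exact measurableSet_lt hc measurable_const

/-- The σ-algebra is arbitrary and only coefficients of earlier blocks are assumed measurable, so
the lemma also applies to the σ-algebra generated by the past. -/
theorem measurable_battery {mΩ : MeasurableSpace Ω} (hE : Measurable E₀) {n : ℕ}
    (hh : ∀ k < n, ∀ l, Measurable (h k l)) : Measurable (P.battery h E₀ n) := by
  classical
  induction n with
  | zero => exact hE
  | succ n ih =>
    have hb := ih fun k hk => hh k (hk.trans n.lt_succ_self)
    have hn := hh n n.lt_succ_self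
    have ho : MeasurableSet (P.outage h n) := P.measurableSet_outage (hn _) fun k => hn _
    have hI : MeasurableSet (P.itBlock h E₀ n) :=
      (measurableSet_le measurable_const hb).inter ho.compl
    have hind : Measurable ((P.itBlock h E₀ n).indicator (1 : Ω → ℝ)) :=
      measurable_indicator_one hI
    have hv : Measurable (P.harvest h n) := P.measurable_harvest fun k => hn _
    rw [show P.battery h E₀ (n + 1) = fun ω => _ from funext fun ω => P.battery_succ n ω]
    exact (hb.add ((hind.const_sub 1).mul hv)).sub (hind.const_mul _)

theorem measurableSet_itBlock {mΩ : MeasurableSpace Ω} (hE : Measurable E₀) {n : ℕ}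
    (hh : ∀ k < n, ∀ l, Measurable (h k l)) (hSD : Measurable (h n Link.SD))
    (hJD : ∀ k, Measurable (h n (Link.JD k))) : MeasurableSet (P.itBlock h E₀ n) :=
  (measurableSet_le measurable_const (P.measurable_battery hE hh)).inter
    (P.measurableSet_outage hSD hJD).compl

end Params

end PoweredJammer

namespace PoweredJammer

open MeasureTheory ProbabilityTheory Filter Topology

/-! ### Information available before a block -/

section Information

variable {Ω : Type*} {N : ℕ}

/-- The σ-algebras generated by the initial energy (index `none`) and by each of the fading
coefficients (index `some (n, l)`). -/
@[reducible]
noncomputable def sourceAlgebra (h : ℕ → Link N → Ω → ℂ) (E₀ : Ω → ℝ) :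
    Option (ℕ × Link N) → MeasurableSpace Ω :=
  fun o => o.elim (MeasurableSpace.comap E₀ inferInstance)
    fun i => MeasurableSpace.comap (h i.1 i.2) inferInstance

/-- The initial energy and all the coefficients of the blocks before block `n`. -/
def beforeBlock (N n : ℕ) : Set (Option (ℕ × Link N)) :=
  {o | ∀ i, o = some i → i.1 < n}

/-- The data of `beforeBlock`, and the coefficients that decide about an outage in block `n`. -/
def beforeHarvest (N n : ℕ) : Set (Option (ℕ × Link N)) :=
  {o | ∀ i, o = some i → i.1 < n ∨ (i.1 = n ∧ ∀ k, i.2 ≠ Link.SJ k)}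

theorem monotone_beforeBlock : Monotone (beforeBlock N) :=
  fun _ _ hab _ ho i hi => (ho i hi).trans_le hab

theorem monotone_beforeHarvest : Monotone (beforeHarvest N) := by
  refine monotone_nat_of_le_succ fun n o ho i hi => Or.inl ?_
  rcases ho i hi with h | h <;> omega

/-- The filtration generated by an increasing sequence of sets of data. -/
noncomputable def sourceFiltration {mΩ : MeasurableSpace Ω} {h : ℕ → Link N → Ω → ℂ} {E₀ : Ω → ℝ}
    (hle : ∀ o, sourceAlgebra h E₀ o ≤ mΩ) {S : ℕ → Set (Option (ℕ × Link N))}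
    (hS : Monotone S) : Filtration ℕ mΩ where
  seq n := ⨆ o ∈ S n, sourceAlgebra h E₀ o
  mono' _ _ hab := biSup_mono fun _ ho => hS hab ho
  le' _ := iSup₂_le fun o _ => hle o

theorem measurable_coeff_of_mem {h : ℕ → Link N → Ω → ℂ} {E₀ : Ω → ℝ}
    {S : Set (Option (ℕ × Link N))} {n : ℕ} {l : Link N} (hS : some (n, l) ∈ S) :
    Measurable[⨆ o ∈ S, sourceAlgebra h E₀ o] (h n l) :=
  measurable_iff_comap_le.2 (le_iSup₂ (f := fun o (_ : o ∈ S) => sourceAlgebra h E₀ o) _ hS)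

theorem measurable_init_of_mem {h : ℕ → Link N → Ω → ℂ} {E₀ : Ω → ℝ}
    {S : Set (Option (ℕ × Link N))} (hS : none ∈ S) :
    Measurable[⨆ o ∈ S, sourceAlgebra h E₀ o] E₀ :=
  measurable_iff_comap_le.2 (le_iSup₂ (f := fun o (_ : o ∈ S) => sourceAlgebra h E₀ o) _ hS)

end Information

/-! ### Dependence of the battery and the block events on the data. -/

section Params

variable {Ω : Type*} {P : Params} {h : ℕ → Link P.NJ → Ω → ℂ} {E₀ : Ω → ℝ}

theorem measurable_battery_beforeBlock (n : ℕ) :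
    Measurable[⨆ o ∈ beforeBlock P.NJ n, sourceAlgebra h E₀ o] (P.battery h E₀ n) :=
  P.measurable_battery (measurable_init_of_mem fun _ hi => by simp at hi)
    fun _ hk _ => measurable_coeff_of_mem fun _ hi => by cases hi; exact hk

/-- The battery level comes from earlier blocks, and an outage from the SD and JD links of block
`n`. No SJ link of block `n` enters, so the decision is independent of the energy that the block
could supply. -/
theorem measurableSet_itBlock_beforeHarvest (n : ℕ) :
    MeasurableSet[⨆ o ∈ beforeHarvest P.NJ n, sourceAlgebra h E₀ o] (P.itBlock h E₀ n) :=
  P.measurableSet_itBlock (measurable_init_of_mem fun _ hi => by simp at hi)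
    (fun _ hk _ => measurable_coeff_of_mem fun _ hi => by cases hi; exact Or.inl hk)
    (measurable_coeff_of_mem fun _ hi => by cases hi; exact Or.inr ⟨rfl, by simp⟩)
    (fun _ => measurable_coeff_of_mem fun _ hi => by cases hi; exact Or.inr ⟨rfl, by simp⟩)

theorem measurableSet_outage_block (n : ℕ) :
    MeasurableSet[⨆ o ∈ {o | ∃ l, o = some (n, l)}, sourceAlgebra h E₀ o] (P.outage h n) :=
  P.measurableSet_outage (measurable_coeff_of_mem ⟨_, rfl⟩)
    fun _ => measurable_coeff_of_mem ⟨_, rfl⟩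

theorem measurable_harvest_block (n : ℕ) :
    Measurable[⨆ o ∈ {o | ∃ k, o = some (n, Link.SJ k)}, sourceAlgebra h E₀ o]
      (P.harvest h n) :=
  P.measurable_harvest fun k => measurable_coeff_of_mem ⟨k, rfl⟩

end Params

/-! ### Probabilistic consequences of the fading model. -/

namespace IsFadingModel

variable {Ω : Type*} [mΩ : MeasurableSpace Ω] {μ : Measure Ω} {P : Params}
  {h : ℕ → Link P.NJ → Ω → ℂ} {E₀ : Ω → ℝ}

theorem sourceAlgebra_le (hM : IsFadingModel P μ h E₀) (o : Option (ℕ × Link P.NJ)) :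
    sourceAlgebra h E₀ o ≤ mΩ := by
  cases o with
  | none => exact hM.measurable_init.comap_le
  | some i => exact (hM.measurable_h i.1 i.2).comap_le

/-- Reduces every independence claim to disjointness of two index sets. -/
theorem indep_sourceAlgebra (hM : IsFadingModel P μ h E₀) {S T : Set (Option (ℕ × Link P.NJ))}
    (hST : Disjoint S T) :
    Indep (⨆ o ∈ S, sourceAlgebra h E₀ o) (⨆ o ∈ T, sourceAlgebra h E₀ o) μ := by
  refine indep_iSup_of_disjoint hM.sourceAlgebra_le (iIndep_option hM.indep_h.iIndep ?_) hST
  -- The product σ-algebra pulls back to the supremum of the σ-algebras of the coordinates.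
  have := (IndepFun_iff_Indep _ _ _).1 hM.indep_init
  simpa only [MeasurableSpace.pi, MeasurableSpace.comap_iSup, MeasurableSpace.comap_comp,
    Function.comp_def] using this

theorem measurable_battery (hM : IsFadingModel P μ h E₀) (n : ℕ) :
    Measurable (P.battery h E₀ n) :=
  P.measurable_battery hM.measurable_init fun k _ l => hM.measurable_h k l

theorem measurableSet_outage (hM : IsFadingModel P μ h E₀) (n : ℕ) :
    MeasurableSet (P.outage h n) :=
  P.measurableSet_outage (hM.measurable_h _ _) fun _ => hM.measurable_h _ _

theorem measurableSet_itBlock (hM : IsFadingModel P μ h E₀) (n : ℕ) :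
    MeasurableSet (P.itBlock h E₀ n) :=
  (measurableSet_le measurable_const (hM.measurable_battery n)).inter
    (hM.measurableSet_outage n).compl

/-! ### Harvested energy -/

theorem memLp_norm_sq (hM : IsFadingModel P μ h E₀) (n : ℕ) (l : Link P.NJ) :
    MemLp (fun ω => ‖h n l ω‖ ^ 2) 2 μ := by
  have := memLp_norm_sq_stdComplexGaussian
  rw [← hM.law_h n l] at this
  exact this.comp_of_map (hM.measurable_h n l).aemeasurable

theorem integral_comp_coeff (hM : IsFadingModel P μ h E₀) (n : ℕ) (l : Link P.NJ) {f : ℂ → ℝ}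
    (hf : Measurable f) : ∫ ω, f (h n l ω) ∂μ = ∫ z, f z ∂stdComplexGaussian := by
  rw [← hM.law_h n l, integral_map (hM.measurable_h n l).aemeasurable hf.aestronglyMeasurable]

theorem memLp_harvest (hM : IsFadingModel P μ h E₀) (n : ℕ) :
    MemLp (P.harvest h n) 2 μ := by
  rw [show P.harvest h n = fun ω => _ from funext fun ω => P.harvest_eq n ω]
  exact memLp_finsetSum _ fun k _ => (hM.memLp_norm_sq n _).const_mul _

theorem integral_harvest [IsProbabilityMeasure μ] (hM : IsFadingModel P μ h E₀) (n : ℕ) :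
    ∫ ω, P.harvest h n ω ∂μ = P.ρJ := by
  simp_rw [P.harvest_eq]
  rw [integral_finsetSum _
    fun k _ => ((hM.memLp_norm_sq n _).integrable one_le_two).const_mul _]
  simp_rw [integral_const_mul,
    hM.integral_comp_coeff n _ (f := fun z => ‖z‖ ^ 2) (by fun_prop),
    integral_norm_sq_stdComplexGaussian]
  simp only [Finset.sum_const, Finset.card_univ, Fintype.card_fin, nsmul_eq_mul, Params.ρJ]
  ring

/-- The variance is at most the second moment, and Cauchy–Schwarz over the antennas bounds that by
fourth moments of single coefficients, whose law does not depend on `n`. -/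
theorem exists_integral_sq_harvest_sub_le [IsProbabilityMeasure μ]
    (hM : IsFadingModel P μ h E₀) :
    ∃ C, ∀ n, ∫ ω, (P.harvest h n ω - P.ρJ) ^ 2 ∂μ ≤ C := by
  set κ := P.η * P.Ps * P.T / P.dSJ ^ P.m with hκ
  refine ⟨P.NJ * ∑ k : Fin P.NJ, κ ^ 2 * ∫ z, (‖z‖ ^ 2) ^ 2 ∂stdComplexGaussian, fun n => ?_⟩
  have h2 := hM.memLp_harvest n
  have hsq : ∀ k : Fin P.NJ, Integrable (fun ω => (κ * ‖h n (Link.SJ k) ω‖ ^ 2) ^ 2) μ :=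
    fun k => ((hM.memLp_norm_sq n (Link.SJ k)).const_mul κ).integrable_sq
  calc ∫ ω, (P.harvest h n ω - P.ρJ) ^ 2 ∂μ = Var[P.harvest h n; μ] := by
        rw [variance_eq_integral h2.aemeasurable, hM.integral_harvest n]
    _ ≤ ∫ ω, P.harvest h n ω ^ 2 ∂μ := variance_le_expectation_sq h2.aestronglyMeasurable
    _ ≤ ∫ ω, P.NJ * ∑ k : Fin P.NJ, (κ * ‖h n (Link.SJ k) ω‖ ^ 2) ^ 2 ∂μ := by
        refine integral_mono h2.integrable_sq
          ((integrable_finsetSum _ fun k _ => hsq k).const_mul _) fun ω => ?_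
        simp only [P.harvest_eq]
        simpa using sq_sum_le_card_mul_sum_sq (s := Finset.univ)
          (f := fun k : Fin P.NJ => κ * ‖h n (Link.SJ k) ω‖ ^ 2)
    _ = _ := by
        rw [integral_const_mul, integral_finsetSum _ fun k _ => hsq k]
        simp_rw [mul_pow κ, integral_const_mul,
          hM.integral_comp_coeff n _ (f := fun z => (‖z‖ ^ 2) ^ 2) (by fun_prop)]

/-! ### Outage probability -/

/-- For one antenna, condition on the jammer link: the exponential tail gives `exp (-a) * exp (-(b *
‖z‖ ^ 2))`, and the Laplace transform integrates out `z`. Otherwise the exponential tail alone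
suffices. -/
theorem measureReal_compl_outage [IsProbabilityMeasure μ] (hM : IsFadingModel P μ h E₀) (n : ℕ) :
    μ.real (P.outage h n)ᶜ = 1 - P.pco := by
  have hθ := P.threshold_nonneg
  have hρ := P.ρd_pos
  have hφ := P.φ_nonneg
  have ha : 0 ≤ (2 ^ P.Rt - 1) / P.ρd := by positivity
  by_cases h1 : P.NJ = 1
  · set a := (2 ^ P.Rt - 1) / P.ρd with ha_def
    set b := P.φ * (2 ^ P.Rt - 1) with hb_def
    have hb : 0 ≤ b := by positivity
    set g : Ω → ℂ := h n (Link.JD ⟨0, P.NJ_pos⟩)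
    set s : Set (ℂ × ℂ) := {z | a + b * ‖z.1‖ ^ 2 ≤ ‖z.2‖ ^ 2} with hs_def
    have hs : MeasurableSet s := measurableSet_le (by fun_prop) (by fun_prop)
    have hset : (P.outage h n)ᶜ = (fun ω => (g ω, h n Link.SD ω)) ⁻¹' s := by
      ext ω
      exact P.notMem_outage_iff_of_NJ_eq_one h1 n ω
    have hind : IndepFun g (h n Link.SD) μ :=
      hM.indep_h.indepFun (i := (n, Link.JD ⟨0, P.NJ_pos⟩)) (j := (n, Link.SD)) (by simp)
    have hg : Measurable g := hM.measurable_h _ _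
    have hd : Measurable (h n Link.SD) := hM.measurable_h _ _
    have hlaw := (indepFun_iff_map_prod_eq_prod_map_map hg.aemeasurable hd.aemeasurable).1 hind
    rw [hM.law_h, hM.law_h] at hlaw
    have hmeas : μ (P.outage h n)ᶜ = ENNReal.ofReal (Real.exp (-a) / (1 + b)) := by
      rw [hset, ← Measure.map_apply (hg.prodMk hd) hs, hlaw, Measure.prod_apply hs]
      have hsec : ∀ z : ℂ, stdComplexGaussian (Prod.mk z ⁻¹' s) =
          ENNReal.ofReal (Real.exp (-a)) * ENNReal.ofReal (Real.exp (-(b * ‖z‖ ^ 2))) := by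
        intro z
        rw [← ENNReal.ofReal_mul (Real.exp_pos _).le, ← Real.exp_add, ← neg_add,
          ← stdComplexGaussian_le_norm_sq (by positivity)]
        rfl
      simp_rw [hsec]
      rw [lintegral_const_mul _ (by fun_prop),
        lintegral_exp_neg_mul_norm_sq_stdComplexGaussian hb,
        ← ENNReal.ofReal_mul (Real.exp_pos _).le, mul_one_div]
    rw [measureReal_def, hmeas, ENNReal.toReal_ofReal (by positivity), Params.pco, if_pos h1,
      sub_sub_cancel]
  · have hset : (P.outage h n)ᶜ =
        h n Link.SD ⁻¹' {z | (2 ^ P.Rt - 1) / P.ρd ≤ ‖z‖ ^ 2} := by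
      ext ω
      exact P.notMem_outage_iff_of_NJ_ne_one h1 n ω
    rw [measureReal_def, hset, ← Measure.map_apply (hM.measurable_h _ _)
      (measurableSet_le measurable_const (by fun_prop)), hM.law_h,
      stdComplexGaussian_le_norm_sq ha, ENNReal.toReal_ofReal (Real.exp_pos _).le, Params.pco,
      if_neg h1, sub_sub_cancel]

theorem measureReal_outage [IsProbabilityMeasure μ] (hM : IsFadingModel P μ h E₀) (n : ℕ) :
    μ.real (P.outage h n) = P.pco := by
  have h1 := hM.measureReal_compl_outage n
  rw [probReal_compl_eq_one_sub (hM.measurableSet_outage n)] at h1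
  linarith

/-! ### Laws of large numbers along the path -/

theorem indep_block (hM : IsFadingModel P μ h E₀) (n : ℕ) :
    Indep (⨆ o ∈ beforeBlock P.NJ n, sourceAlgebra h E₀ o)
      (⨆ o ∈ {o | ∃ l, o = some (n, l)}, sourceAlgebra h E₀ o) μ := by
  refine hM.indep_sourceAlgebra (Set.disjoint_left.2 ?_)
  rintro o ho ⟨l, rfl⟩
  exact lt_irrefl _ (ho _ rfl)

theorem indep_harvest (hM : IsFadingModel P μ h E₀) (n : ℕ) :
    Indep (⨆ o ∈ beforeHarvest P.NJ n, sourceAlgebra h E₀ o)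
      (⨆ o ∈ {o | ∃ k, o = some (n, Link.SJ k)}, sourceAlgebra h E₀ o) μ := by
  refine hM.indep_sourceAlgebra (Set.disjoint_left.2 ?_)
  rintro o ho ⟨k, rfl⟩
  rcases ho _ rfl with h1 | h1
  · exact lt_irrefl _ h1
  · exact h1.2 k rfl

/-- The weight selects PT blocks and involves the outage of the current block, hence the filtration
of `beforeHarvest`. -/
theorem ae_tendsto_avg_harvest [IsProbabilityMeasure μ] (hM : IsFadingModel P μ h E₀) :
    ∀ᵐ ω ∂μ, Tendsto (fun n : ℕ => (∑ i ∈ Finset.range n,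
      (1 - (P.itBlock h E₀ i).indicator 1 ω) * (P.harvest h i ω - P.ρJ)) / n) atTop (𝓝 0) := by
  obtain ⟨C, hC⟩ := hM.exists_integral_sq_harvest_sub_le
  refine ae_tendsto_avg_predictable_mul
    (sourceFiltration hM.sourceAlgebra_le monotone_beforeHarvest) (C := C)
    (W := fun i ω => 1 - (P.itBlock h E₀ i).indicator 1 ω)
    (Z := fun i ω => P.harvest h i ω - P.ρJ) (fun n => ?_) (fun n ω => ?_) (fun n => ?_)
    (fun n => (hM.memLp_harvest n).sub (memLp_const _)) hC (fun n => ?_) (fun n => ?_)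
  · exact (Params.measurable_indicator_one (measurableSet_itBlock_beforeHarvest n)).const_sub 1
  · by_cases hω : ω ∈ P.itBlock h E₀ n <;> simp [hω]
  · exact Measurable.sub_const (P.measurable_harvest fun k =>
      measurable_coeff_of_mem fun _ hi => by cases hi; exact Or.inl n.lt_succ_self) _
  · rw [integral_sub ((hM.memLp_harvest n).integrable one_le_two) (integrable_const _),
      hM.integral_harvest]
    simp
  · refine indep_of_indep_of_le_right (hM.indep_harvest n) (measurable_iff_comap_le.1 ?_)
    exact (measurable_harvest_block n).sub_const _

/-- Here the weight is only the energy test, already settled by earlier blocks, while the noise is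
the outage of block `i`, hence the filtration of `beforeBlock`. -/
theorem ae_tendsto_avg_compl_outage [IsProbabilityMeasure μ] (hM : IsFadingModel P μ h E₀) :
    ∀ᵐ ω ∂μ, Tendsto (fun n : ℕ => (∑ i ∈ Finset.range n,
      {ω | P.PJ * P.T ≤ P.battery h E₀ i ω}.indicator 1 ω *
        ((P.outage h i)ᶜ.indicator 1 ω - (1 - P.pco))) / n) atTop (𝓝 0) := by
  have hL : ∀ n, MemLp (fun ω => (P.outage h n)ᶜ.indicator (1 : Ω → ℝ) ω - (1 - P.pco)) 2 μ :=
    fun n => (memLp_indicator_const 2 (hM.measurableSet_outage n).compl (1 : ℝ)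
      (Or.inr (measure_ne_top _ _))).sub (memLp_const _)
  refine ae_tendsto_avg_predictable_mul
    (sourceFiltration hM.sourceAlgebra_le monotone_beforeBlock) (C := (1 + |1 - P.pco|) ^ 2)
    (W := fun i => {ω | P.PJ * P.T ≤ P.battery h E₀ i ω}.indicator 1)
    (Z := fun i ω => (P.outage h i)ᶜ.indicator 1 ω - (1 - P.pco)) (fun n => ?_) (fun n ω => ?_)
    (fun n => ?_) hL (fun n => ?_) (fun n => ?_) (fun n => ?_)
  · exact Params.measurable_indicator_one (measurable_battery_beforeBlock n measurableSet_Ici)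
  · by_cases hω : ω ∈ {ω | P.PJ * P.T ≤ P.battery h E₀ n ω} <;> simp [hω]
  · exact (Params.measurable_indicator_one (P.measurableSet_outage
      (measurable_coeff_of_mem fun _ hi => by cases hi; exact n.lt_succ_self)
      fun _ => measurable_coeff_of_mem fun _ hi => by
        cases hi; exact n.lt_succ_self).compl).sub_const _
  · refine (integral_mono (hL n).integrable_sq (integrable_const _) fun ω => ?_).trans_eq
      (by simp : ∫ _, (1 + |1 - P.pco|) ^ 2 ∂μ = (1 + |1 - P.pco|) ^ 2)
    -- The constant `C` comes from the triangle inequality: an indicator minus `1 - pco` is at most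
    -- `1 + |1 - pco|` in modulus.
    refine sq_le_sq.2 (le_trans ?_ (le_abs_self _))
    refine (abs_sub _ _).trans (add_le_add_left ?_ _)
    by_cases hω : ω ∈ (P.outage h n)ᶜ <;> simp [hω]
  · have hint : Integrable ((P.outage h n)ᶜ.indicator (1 : Ω → ℝ)) μ :=
      (integrable_const (1 : ℝ)).indicator (hM.measurableSet_outage n).compl
    rw [integral_sub hint (integrable_const _),
      integral_indicator_one (hM.measurableSet_outage n).compl, hM.measureReal_compl_outage]
    simp
  · refine indep_of_indep_of_le_right (hM.indep_block n) (measurable_iff_comap_le.1 ?_)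
    exact (Params.measurable_indicator_one (measurableSet_outage_block n).compl).sub_const _

/-! ### Frequency of the information transmission blocks -/

/-- Almost every path is a storage process: `b` tests the energy, `y` the absence of outage, and `x
= b * y` marks IT blocks. -/
theorem ae_tendsto_numIT_div [IsProbabilityMeasure μ] (hM : IsFadingModel P μ h E₀) :
    ∀ᵐ ω ∂μ, Tendsto (fun n : ℕ => (P.numIT h E₀ n ω : ℝ) / n) atTop (𝓝 P.ptx) := by
  filter_upwards [hM.ae_tendsto_avg_harvest, hM.ae_tendsto_avg_compl_outage] with ω hX hy
  simp_rw [P.numIT_eq_sum, P.ptx_eq_min]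
  refine tendsto_avg_of_storage (E := fun n => P.battery h E₀ n ω)
    (mul_nonneg P.PJ_nonneg P.T_pos.le) P.ρJ_pos (sub_nonneg.2 P.pco_lt_one.le)
    (fun n => P.battery_nonneg hM.init_nonneg n ω) (fun n => P.battery_succ n ω) (fun n => ?_)
    (fun n hn => ?_) (fun n hn => ?_) hX hy
  · rw [P.itBlock_eq, Set.inter_indicator_one, Pi.mul_apply]
  · rw [Set.indicator_of_mem (by exact hn)]; rfl
  · rw [Set.indicator_of_notMem (by exact not_le.2 hn)]

/-- The averaged probability is the expectation of the IT frequency, which is bounded by `1`, so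
dominated convergence applies. -/
theorem tendsto_avg_measureReal_itBlock [IsProbabilityMeasure μ] (hM : IsFadingModel P μ h E₀) :
    Tendsto (fun n : ℕ => (∑ i ∈ Finset.range n, μ.real (P.itBlock h E₀ i)) / n)
      atTop (𝓝 P.ptx) := by
  have hind : ∀ i, Integrable ((P.itBlock h E₀ i).indicator (1 : Ω → ℝ)) μ := fun i =>
    (integrable_const (1 : ℝ)).indicator (hM.measurableSet_itBlock i)
  have hint : ∀ n : ℕ, Integrable (fun ω => (P.numIT h E₀ n ω : ℝ) / n) μ := fun n => by
    simp_rw [P.numIT_eq_sum]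
    exact (integrable_finsetSum _ fun i _ => hind i).div_const _
  have hlim : Tendsto (fun n : ℕ => ∫ ω, (P.numIT h E₀ n ω : ℝ) / n ∂μ) atTop
      (𝓝 (∫ _, P.ptx ∂μ)) := by
    refine tendsto_integral_of_dominated_convergence (fun _ => 1)
      (fun n => (hint n).aestronglyMeasurable) (integrable_const _)
      (fun n => ae_of_all _ fun ω => ?_) hM.ae_tendsto_numIT_div
    have hle : (P.numIT h E₀ n ω : ℝ) ≤ n := by
      classical
      exact_mod_cast (Finset.card_filter_le _ _).trans_eq (Finset.card_range n)
    rw [Real.norm_of_nonneg (by positivity)]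
    exact div_le_one_of_le₀ hle n.cast_nonneg
  simp only [integral_const, probReal_univ, one_smul] at hlim
  refine hlim.congr fun n => ?_
  simp_rw [P.numIT_eq_sum]
  rw [integral_div, integral_finsetSum _ fun i _ => hind i]
  simp_rw [fun i => integral_indicator_one (μ := μ) (hM.measurableSet_itBlock i)]

/-- The battery is independent of the current outage. The energy factor is expressed through the law
of the battery so that stationarity can be substituted. -/
theorem measureReal_itBlock [IsProbabilityMeasure μ] (hM : IsFadingModel P μ h E₀) (n : ℕ) :
    μ.real (P.itBlock h E₀ n) =
      (μ.map (P.battery h E₀ n)).real (Set.Ici (P.PJ * P.T)) * (1 - P.pco) := by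
  have hi := (Indep_iff _ _ _).1 (hM.indep_block n) _ _
    (measurable_battery_beforeBlock n (measurableSet_Ici (a := P.PJ * P.T)))
    (measurableSet_outage_block n).compl
  rw [map_measureReal_apply (hM.measurable_battery n) measurableSet_Ici,
    ← hM.measureReal_compl_outage n, measureReal_def, measureReal_def, measureReal_def,
    ← ENNReal.toReal_mul, ← hi]
  rfl

/-- Under stationarity the IT probability is the same in every block, so it equals its own Cesàro
limit. -/
theorem measureReal_itBlock_of_stationary [IsProbabilityMeasure μ] (hM : IsFadingModel P μ h E₀)
    (hst : ∀ n, μ.map (P.battery h E₀ n) = μ.map E₀) (n : ℕ) :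
    μ.real (P.itBlock h E₀ n) = P.ptx := by
  have hlim := hM.tendsto_avg_measureReal_itBlock
  simp only [hM.measureReal_itBlock, hst] at hlim ⊢
  refine tendsto_nhds_unique (tendsto_const_nhds.congr' ?_) hlim
  filter_upwards [eventually_gt_atTop 0] with k hk
  have : (k : ℝ) ≠ 0 := by exact_mod_cast hk.ne'
  simp only [Finset.sum_const, Finset.card_range, nsmul_eq_mul]
  field_simp

theorem ae_tendsto_avg_deliveredRate [IsProbabilityMeasure μ] (hM : IsFadingModel P μ h E₀) :
    ∀ᵐ ω ∂μ, Tendsto (fun n : ℕ => (∑ i ∈ Finset.range n, P.deliveredRate h E₀ i ω) / n)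
      atTop (𝓝 (P.ptx * P.Rs)) := by
  filter_upwards [hM.ae_tendsto_numIT_div] with ω hω
  refine (hω.mul_const P.Rs).congr fun n => ?_
  rw [P.numIT_eq_sum, div_mul_eq_mul_div, Finset.sum_mul]
  congr 1
  refine Finset.sum_congr rfl fun i _ => ?_
  by_cases hi : ω ∈ P.itBlock h E₀ i <;> simp [Params.deliveredRate, hi]

end IsFadingModel

end PoweredJammer

open MeasureTheory ProbabilityTheory Filter Topology PoweredJammer in
theorem theorem1 {Ω : Type*} [MeasurableSpace Ω] (μ : Measure Ω) [IsProbabilityMeasure μ]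
    (P : Params) (h : ℕ → Link P.NJ → Ω → ℂ) (E₀ : Ω → ℝ)
    (hM : IsFadingModel P μ h E₀) :
    -- mean harvested energy
    (∀ n, Integrable (P.harvest h n) μ ∧ ∫ ω, P.harvest h n ω ∂μ = P.ρJ) ∧
    -- connection outage probability
    (∀ n, μ.real (P.outage h n) = P.pco) ∧
    -- long-run fraction of information transmission blocks
    (∀ᵐ ω ∂μ, Tendsto (fun n : ℕ => (P.numIT h E₀ n ω : ℝ) / n) atTop (𝓝 P.ptx)) ∧
    -- probability that an arbitrary one of the first `n` blocks is used for transmission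
    Tendsto (fun n : ℕ => (∑ i ∈ Finset.range n, μ.real (P.itBlock h E₀ i)) / n)
      atTop (𝓝 P.ptx) ∧
    -- stationary probability that a block is used for transmission
    ((∀ n, μ.map (P.battery h E₀ n) = μ.map E₀) → ∀ n, μ.real (P.itBlock h E₀ n) = P.ptx) ∧
    -- achievable throughput
    (∀ᵐ ω ∂μ, Tendsto
      (fun n : ℕ => (∑ i ∈ Finset.range n, P.deliveredRate h E₀ i ω) / n)
      atTop (𝓝 (P.ptx * P.Rs))) := by
  exact ⟨fun n => ⟨(hM.memLp_harvest n).integrable one_le_two, hM.integral_harvest n⟩,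
    hM.measureReal_outage, hM.ae_tendsto_numIT_div, hM.tendsto_avg_measureReal_itBlock,
    hM.measureReal_itBlock_of_stationary, hM.ae_tendsto_avg_deliveredRate⟩
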